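/- Let $T>0$, let $\Sigma\in\mathbb{R}^{N\times N}$ be symmetric positive definite with Cholesky decomposition $\Sigma=LL^\top$ ($L$ lower triangular, with columns $L_1,\dots,L_N$), and let $W$ be an $N$-dimensional Brownian motion with $W(0)=a\in\mathbb{R}^N$ and $W(t)\sim\mathcal N(a,t\Sigma)$. Let $P\in\mathbb{R}^{K\times N}$ satisfy $PL_j\neq 0$ for $j=1,\dots,N$, let $\varepsilon\sim\mathcal N(0,T\Omega)$ be independent of $\{W(t),\ t\in[0,T]\}$, where $\Omega\in\mathbb{R}^{K\times K}$ is symmetric positive definite, and put $Y(0,T)=PW(T)+\varepsilon$. Let $\beta_1=\frac1T\Sigma P^\top(P\Sigma P^\top+\Omega)^{-1}$ and $H=\frac1T(PL)^\top(P\Sigma P^\top+\Omega)^{-1}PL$. Then the conditioned process $B(t)=(W(t)\mid Y(0,T)=y)$, $t\in[0,T]$, satisfies 1. $B(0)=a$ with probability $1$; 2. $B$ is a Gaussian process; 3. $\mathbb{E}[B(t)]=a+t\beta_1(y-Pa)$ for $t\in[0,T]$; 4. $\mathrm{Cov}(B(t),B(s))=L\big(\min\{s,t\}I_N-st\,H\big)L^\top$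 for $s,t\in[0,T]$; 5. with probability $1$, $t\mapsto B_i(t)$ is continuous on $[0,T]$ for every $i=1,\dots,N$. The matrix $H$ is symmetric positive semidefinite with strictly positive diagonal entries, and it is positive definite if and only if $P$ is injective as a linear map $\mathbb{R}^N\to\mathbb{R}^K$. Here conditioning on $Y(0,T)=y$ is meant in both of the following senses: (i) for every regular conditional probability $y\mapsto\mathbb{P}(\,\cdot\mid Y(0,T)=y)$ on the underlying probability space, (1)–(5) hold for $W|_{[0,T]}$ under $\mathbb{P}(\,\cdot\mid Y(0,T)=y)$ for almost every $y$ with respect to the law of $Y(0,T)$; (ii) the regular conditional law of the path $W|_{[0,T]}$ on $C([0,T],\mathbb{R}^N)$ given $Y(0,T)$ has a version that is weakly continuous in $y$, and for every such version (1)–(5) hold for every $y\in\mathbb{R}^K$. -/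

import Mathlib

open MeasureTheory ProbabilityTheory
open scoped NNReal ENNReal Matrix BoundedContinuousFunction

noncomputable section

/-- `W` is an `N`-dimensional (correlated) Brownian motion started at `a` with covariance matrix
`Sig`, i.e. `W 0 = a` almost surely, the increments are independent,
`W t - W s ∼ N(0, (t - s) Sig)` for `s ≤ t` (so `W t ∼ N(a, t Sig)`), and the paths are almost
surely continuous. -/
structure IsCorrelatedBrownianMotion {S : Type*} [MeasurableSpace S] {N : ℕ}
    (a : EuclideanSpace ℝ (Fin N)) (Sig : Matrix (Fin N) (Fin N) ℝ)
    (W : ℝ≥0 → S → EuclideanSpace ℝ (Fin N)) (Pr : Measure S) : Prop where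
  measurable : ∀ t, Measurable (W t)
  start : ∀ᵐ ω ∂Pr, W 0 ω = a
  indep_increments : HasIndepIncrements W Pr
  law_increment : ∀ s t : ℝ≥0, s ≤ t →
    HasLaw (fun ω => W t ω - W s ω) (multivariateGaussian 0 (((t : ℝ) - (s : ℝ)) • Sig)) Pr
  continuous_paths : ∀ᵐ ω ∂Pr, Continuous (fun t => W t ω)

/-- The Euclidean vector `A x`. -/
def euclideanMulVec {m n : ℕ} (A : Matrix (Fin m) (Fin n) ℝ) (x : EuclideanSpace ℝ (Fin n)) :
    EuclideanSpace ℝ (Fin m) :=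
  WithLp.toLp 2 (A *ᵥ WithLp.ofLp x)

/-- `L` is a Cholesky factor of `Sig`: lower triangular with `Sig = L Lᵀ`. -/
structure IsCholeskyFactor {N : ℕ} (Sig L : Matrix (Fin N) (Fin N) ℝ) : Prop where
  lower_triangular : ∀ i j, i < j → L i j = 0
  eq_mul_transpose : Sig = L * Lᵀ

/-- The space of continuous paths `[0, T] → ℝᴺ`, with the topology of uniform convergence. -/
abbrev PathSpace (T : ℝ≥0) (N : ℕ) : Type :=
  C(Set.Icc (0 : ℝ≥0) T, EuclideanSpace ℝ (Fin N))

instance instMeasurableSpacePathSpace (T : ℝ≥0) (N : ℕ) : MeasurableSpace (PathSpace T N) :=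
  borel _

instance instBorelSpacePathSpace (T : ℝ≥0) (N : ℕ) : BorelSpace (PathSpace T N) := ⟨rfl⟩

/-- The canonical (coordinate) process on path space. -/
def pathEval {T : ℝ≥0} {N : ℕ} (t : Set.Icc (0 : ℝ≥0) T) (w : PathSpace T N) :
    EuclideanSpace ℝ (Fin N) := w t

/-- A path as a point of the product space `(ℝᴺ)^[0, T]` (with its product σ-algebra). -/
def pathCoe {T : ℝ≥0} {N : ℕ} (w : PathSpace T N) :
    Set.Icc (0 : ℝ≥0) T → EuclideanSpace ℝ (Fin N) := fun t => w t

theorem measurable_pathCoe {T : ℝ≥0} {N : ℕ} :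
    Measurable (pathCoe : PathSpace T N → Set.Icc (0 : ℝ≥0) T → EuclideanSpace ℝ (Fin N)) :=
  measurable_pi_lambda _ fun t => (continuous_eval_const t).measurable

/-- `κ` is a regular conditional probability `Pr( · | Y)` on the sample space: a Markov kernel
`y ↦ κ y` such that `Pr(Y ∈ A, E) = ∫_A κ y E (law of Y)(dy)`. -/
def IsRegularCondProb {S F : Type*} [MeasurableSpace S] [MeasurableSpace F]
    (Pr : Measure S) (Y : S → F) (κ : Kernel F S) : Prop :=
  IsMarkovKernel κ ∧ HasCondDistrib (fun ω : S => ω) Y κ Pr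

/-- `ν` is a regular conditional law on `C([0, T], ℝᴺ)` of the process `(W t)_{t ∈ [0, T]}`
given `Y`. -/
def IsCondPathLaw {S F : Type*} [MeasurableSpace S] [MeasurableSpace F] {N : ℕ}
    (T : ℝ≥0) (W : ℝ≥0 → S → EuclideanSpace ℝ (Fin N)) (Y : S → F) (Pr : Measure S)
    (ν : Kernel F (PathSpace T N)) : Prop :=
  IsMarkovKernel ν ∧
    HasCondDistrib (fun ω (t : Set.Icc (0 : ℝ≥0) T) => W t ω) Y (ν.map pathCoe) Pr

/-- `y ↦ ν y` is continuous for weak convergence of measures. -/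
def IsWeaklyContinuousKernel {F E : Type*} [TopologicalSpace F] [MeasurableSpace F]
    [TopologicalSpace E] [MeasurableSpace E] (ν : Kernel F E) : Prop :=
  ∀ f : E →ᵇ ℝ, Continuous fun y => ∫ x, f x ∂(ν y)

/-- Under `Q`, the process `B` on `[0, T]` starts at `a` almost surely, is Gaussian, has mean
function `m` and matrix covariance function `C` (`Cov(B(t)ᵢ, B(s)ⱼ) = C t s i j`), and its
coordinates have almost surely continuous paths. (A Gaussian process is square integrable, so mean
and covariance are genuine.) -/
structure IsContinuousGaussianProcess {S : Type*} [MeasurableSpace S] {N : ℕ} {T : ℝ≥0}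
    (B : Set.Icc (0 : ℝ≥0) T → S → EuclideanSpace ℝ (Fin N)) (Q : Measure S)
    (a : EuclideanSpace ℝ (Fin N))
    (m : Set.Icc (0 : ℝ≥0) T → EuclideanSpace ℝ (Fin N))
    (C : Set.Icc (0 : ℝ≥0) T → Set.Icc (0 : ℝ≥0) T → Matrix (Fin N) (Fin N) ℝ) : Prop where
  start : ∀ᵐ ω ∂Q, B ⟨0, le_refl 0, bot_le⟩ ω = a
  gaussian : IsGaussianProcess B Q
  mean : ∀ t, ∫ ω, B t ω ∂Q = m t
  cov : ∀ s t i j, cov[fun ω => B t ω i, fun ω => B s ω j; Q] = C t s i j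
  continuous_paths : ∀ᵐ ω ∂Q, ∀ i, Continuous fun t => B t ω i

/-- `β₁ = (1/T) Σ Pᵀ (P Σ Pᵀ + Ω)⁻¹`. -/
def betaOne {N K : ℕ} (T : ℝ≥0) (Sig : Matrix (Fin N) (Fin N) ℝ)
    (P : Matrix (Fin K) (Fin N) ℝ) (Om : Matrix (Fin K) (Fin K) ℝ) : Matrix (Fin N) (Fin K) ℝ :=
  (1 / (T : ℝ)) • (Sig * Pᵀ * (P * Sig * Pᵀ + Om)⁻¹)

/-- `H = (1/T) (P L)ᵀ (P Σ Pᵀ + Ω)⁻¹ P L`. -/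
def bridgeMatrix {N K : ℕ} (T : ℝ≥0) (Sig L : Matrix (Fin N) (Fin N) ℝ)
    (P : Matrix (Fin K) (Fin N) ℝ) (Om : Matrix (Fin K) (Fin K) ℝ) : Matrix (Fin N) (Fin N) ℝ :=
  (1 / (T : ℝ)) • ((P * L)ᵀ * (P * Sig * Pᵀ + Om)⁻¹ * (P * L))

/-- `a + t β₁ (y - P a)`. -/
def bridgeMean {N K : ℕ} (T : ℝ≥0) (a : EuclideanSpace ℝ (Fin N))
    (Sig : Matrix (Fin N) (Fin N) ℝ) (P : Matrix (Fin K) (Fin N) ℝ)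
    (Om : Matrix (Fin K) (Fin K) ℝ) (y : EuclideanSpace ℝ (Fin K)) (t : Set.Icc (0 : ℝ≥0) T) :
    EuclideanSpace ℝ (Fin N) :=
  a + ((t : ℝ≥0) : ℝ) • euclideanMulVec (betaOne T Sig P Om) (y - euclideanMulVec P a)

/-- `L (min(s,t) I - s t H) Lᵀ`. -/
def bridgeCov {N K : ℕ} (T : ℝ≥0) (Sig L : Matrix (Fin N) (Fin N) ℝ)
    (P : Matrix (Fin K) (Fin N) ℝ) (Om : Matrix (Fin K) (Fin K) ℝ)
    (t s : Set.Icc (0 : ℝ≥0) T) : Matrix (Fin N) (Fin N) ℝ :=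
  L * ((min ((s : ℝ≥0) : ℝ) ((t : ℝ≥0) : ℝ)) • (1 : Matrix (Fin N) (Fin N) ℝ)
    - (((s : ℝ≥0) : ℝ) * ((t : ℝ≥0) : ℝ)) • bridgeMatrix T Sig L P Om) * Lᵀ

/-- The noisy observation `Y(0,T) = P W(T) + ε`. -/
def noisyView {S : Type*} {N K : ℕ} (T : ℝ≥0) (P : Matrix (Fin K) (Fin N) ℝ)
    (W : ℝ≥0 → S → EuclideanSpace ℝ (Fin N)) (ε : S → EuclideanSpace ℝ (Fin K)) (ω : S) :
    EuclideanSpace ℝ (Fin K) :=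
  euclideanMulVec P (W T ω) + ε ω

end

/-! ### Algebra of `H`, `β₁` and the covariance of the observation -/

section BridgeMatrix

variable {N K : ℕ} {T : ℝ≥0} {Sig L : Matrix (Fin N) (Fin N) ℝ} {P : Matrix (Fin K) (Fin N) ℝ}
  {Om : Matrix (Fin K) (Fin K) ℝ}

/-! The proof is Gaussian linear regression carried out on path space. Put Z = P(W(T) - W(0)) + ε.
Then Z has covariance T(PΣPᵀ + Ω), and W(t) - W(0) has covariance tΣPᵀ with it, so tβ₁ is the
regression coefficient and the residual R(t) = W(t) - W(0) - tβ₁Z is uncorrelated with Z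
(`covariance_bridgeResidual_centeredView`). By joint Gaussianity the whole process R is independent
of Z (`indepFun_bridgeResidual_centeredView`). Almost surely Y = Z + Pa, hence W(t) = R(t) + a +
tβ₁(Y - Pa).

Conditioning on Y = y therefore freezes the second summand: the conditional path law is the law of R
translated by the mean path m(y) (`exists_bridgeKernel`). The start, Gaussianity, mean, covariance
and continuity are then properties of R plus a deterministic path, and weak continuity in y follows
from continuity of y ↦ m(y) in the uniform norm.

Uniqueness carries this to every version. Conditional laws on the Polish path space agree almost
everywhere. Since ε is nondegenerate, the law of Y charges every nonempty open set, so two weakly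
continuous versions agree everywhere. The claims on `H` come from xᵀHx = (1/T)(PLx)ᵀ(PΣPᵀ +
Ω)⁻¹(PLx). -/

theorem posDef_observation_cov (hSig : Sig.PosDef) (hOm : Om.PosDef) (P : Matrix (Fin K) (Fin N) ℝ) :
    (P * Sig * Pᵀ + Om).PosDef := by
  have h := hSig.posSemidef.mul_mul_conjTranspose_same P
  rw [Matrix.conjTranspose_eq_transpose_of_trivial] at h
  exact Matrix.PosDef.posSemidef_add h hOm

theorem IsCholeskyFactor.injective_mulVec (hL : IsCholeskyFactor Sig L) (hSig : Sig.PosDef) :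
    Function.Injective L.mulVec := by
  have hdet : IsUnit (L * Lᵀ).det := by
    rw [← hL.eq_mul_transpose]; exact (Matrix.isUnit_iff_isUnit_det _).1 hSig.isUnit
  rw [Matrix.det_mul] at hdet
  exact Matrix.mulVec_injective_of_isUnit
    ((Matrix.isUnit_iff_isUnit_det _).2 (isUnit_of_mul_isUnit_left hdet))

theorem IsCholeskyFactor.surjective_mulVec (hL : IsCholeskyFactor Sig L) (hSig : Sig.PosDef) :
    Function.Surjective L.mulVec :=
  (LinearMap.injective_iff_surjective (f := Matrix.mulVecLin L)).1 (hL.injective_mulVec hSig)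

theorem bridgeMatrix_posSemidef (hSig : Sig.PosDef) (hOm : Om.PosDef)
    (L : Matrix (Fin N) (Fin N) ℝ) (P : Matrix (Fin K) (Fin N) ℝ) :
    (bridgeMatrix T Sig L P Om).PosSemidef := by
  have h := (posDef_observation_cov hSig hOm P).inv.posSemidef.conjTranspose_mul_mul_same (P * L)
  rw [Matrix.conjTranspose_eq_transpose_of_trivial] at h
  exact h.smul (by positivity)

theorem bridgeMatrix_isSymm (hSig : Sig.PosDef) (hOm : Om.PosDef) :
    (bridgeMatrix T Sig L P Om).IsSymm := by
  have h := (bridgeMatrix_posSemidef (T := T) hSig hOm L P).isHermitian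
  rwa [Matrix.IsHermitian, Matrix.conjTranspose_eq_transpose_of_trivial] at h

/-- Reduces positivity of `H` in direction x to whether PLx vanishes, since the middle factor is
positive definite. -/
theorem dotProduct_bridgeMatrix_mulVec (x : Fin N → ℝ) :
    x ⬝ᵥ bridgeMatrix T Sig L P Om *ᵥ x =
      (1 / (T : ℝ)) * ((P *ᵥ L *ᵥ x) ⬝ᵥ (P * Sig * Pᵀ + Om)⁻¹ *ᵥ (P *ᵥ L *ᵥ x)) := by
  rw [bridgeMatrix, Matrix.smul_mulVec, dotProduct_smul, smul_eq_mul, ← Matrix.mulVec_mulVec,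
    ← Matrix.mulVec_mulVec, Matrix.dotProduct_mulVec, Matrix.vecMul_transpose,
    ← Matrix.mulVec_mulVec]

theorem dotProduct_bridgeMatrix_mulVec_pos (hT : 0 < T) (hSig : Sig.PosDef) (hOm : Om.PosDef)
    {x : Fin N → ℝ} (hx : P *ᵥ L *ᵥ x ≠ 0) : 0 < x ⬝ᵥ bridgeMatrix T Sig L P Om *ᵥ x := by
  rw [dotProduct_bridgeMatrix_mulVec]
  have h := (posDef_observation_cov hSig hOm P).inv.dotProduct_mulVec_pos hx
  rw [star_trivial] at h
  have : (0 : ℝ) < T := hT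
  positivity

theorem bridgeMatrix_diag_pos (hT : 0 < T) (hSig : Sig.PosDef) (hOm : Om.PosDef)
    (hP : ∀ j, P *ᵥ (fun i => L i j) ≠ 0) (i : Fin N) : 0 < bridgeMatrix T Sig L P Om i i := by
  have hcol : L *ᵥ Pi.single i 1 = fun k => L k i := by
    ext k; simp
  have h := dotProduct_bridgeMatrix_mulVec_pos (x := Pi.single i 1) hT hSig hOm
    (by rw [hcol]; exact hP i)
  simpa using h

theorem bridgeMatrix_posDef_iff (hT : 0 < T) (hSig : Sig.PosDef) (hL : IsCholeskyFactor Sig L)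
    (hOm : Om.PosDef) :
    (bridgeMatrix T Sig L P Om).PosDef ↔ Function.Injective P.mulVec := by
  rw [← Matrix.coe_mulVecLin, injective_iff_map_eq_zero]
  refine ⟨fun h z hz => ?_, fun h => ?_⟩
  · obtain ⟨x, rfl⟩ := hL.surjective_mulVec hSig z
    rw [Matrix.mulVecLin_apply] at hz
    by_contra hne
    have hx : x ≠ 0 := by rintro rfl; simp at hne
    have := h.dotProduct_mulVec_pos hx
    rw [star_trivial, dotProduct_bridgeMatrix_mulVec, hz] at this
    simp at this
  · refine Matrix.posDef_iff_dotProduct_mulVec.2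
      ⟨(bridgeMatrix_posSemidef hSig hOm L P).isHermitian, fun x hx => ?_⟩
    rw [star_trivial]
    refine dotProduct_bridgeMatrix_mulVec_pos hT hSig hOm fun h0 => hx ?_
    refine hL.injective_mulVec hSig ?_
    rw [Matrix.mulVec_zero]
    exact h _ h0

/-- The normal equation of the regression; all later cancellations rest on it. -/
theorem betaOne_mul_observation_cov (hT : 0 < T) (hSig : Sig.PosDef) (hOm : Om.PosDef) :
    (T : ℝ) • (betaOne T Sig P Om * (P * Sig * Pᵀ + Om)) = Sig * Pᵀ := by
  have hT' : (T : ℝ) ≠ 0 := NNReal.coe_ne_zero.2 hT.ne'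
  have hdet : IsUnit (P * Sig * Pᵀ + Om).det :=
    (Matrix.isUnit_iff_isUnit_det _).1 (posDef_observation_cov hSig hOm P).isUnit
  rw [betaOne, Matrix.smul_mul, smul_smul, mul_one_div_cancel hT', one_smul,
    Matrix.nonsing_inv_mul_cancel_right _ _ hdet]

theorem bridgeCov_eq (hL : IsCholeskyFactor Sig L) (hSig : Sig.PosDef)
    (t s : Set.Icc (0 : ℝ≥0) T) :
    bridgeCov T Sig L P Om t s = (min ((s : ℝ≥0) : ℝ) ((t : ℝ≥0) : ℝ)) • Sig -
      (((s : ℝ≥0) : ℝ) * ((t : ℝ≥0) : ℝ)) • (betaOne T Sig P Om * P * Sig) := by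
  have hsymm : Sigᵀ = Sig := by
    rw [← Matrix.conjTranspose_eq_transpose_of_trivial]; exact hSig.isHermitian
  have hH : L * bridgeMatrix T Sig L P Om * Lᵀ = betaOne T Sig P Om * P * Sig := by
    have h1 : L * bridgeMatrix T Sig L P Om * Lᵀ = (1 / (T : ℝ)) •
        ((L * Lᵀ) * Pᵀ * (P * Sig * Pᵀ + Om)⁻¹ * P * (L * Lᵀ)) := by
      simp only [bridgeMatrix, Matrix.mul_smul, Matrix.smul_mul, Matrix.transpose_mul,
        Matrix.mul_assoc]
    rw [h1, ← hL.eq_mul_transpose, betaOne, Matrix.smul_mul, Matrix.smul_mul]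
  rw [bridgeCov, mul_sub, sub_mul, Matrix.mul_smul, Matrix.mul_smul, Matrix.smul_mul,
    Matrix.smul_mul, mul_one, ← hL.eq_mul_transpose, hH]

end BridgeMatrix

/-! ### Matrices as continuous linear maps of Euclidean spaces -/

section EuclideanMulVec

variable {m n : ℕ} (A : Matrix (Fin m) (Fin n) ℝ)

@[fun_prop]
theorem continuous_euclideanMulVec : Continuous (euclideanMulVec A) := by
  unfold euclideanMulVec
  fun_prop

theorem euclideanMulVec_add (x y : EuclideanSpace ℝ (Fin n)) :
    euclideanMulVec A (x + y) = euclideanMulVec A x + euclideanMulVec A y := by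
  simp [euclideanMulVec, Matrix.mulVec_add]

theorem euclideanMulVec_smul (c : ℝ) (x : EuclideanSpace ℝ (Fin n)) :
    euclideanMulVec A (c • x) = c • euclideanMulVec A x := by
  simp [euclideanMulVec, Matrix.mulVec_smul]

/-- `euclideanMulVec` as a continuous linear map. -/
def euclideanMulVecCLM : EuclideanSpace ℝ (Fin n) →L[ℝ] EuclideanSpace ℝ (Fin m) where
  toFun := euclideanMulVec A
  map_add' := euclideanMulVec_add A
  map_smul' := euclideanMulVec_smul A
  cont := continuous_euclideanMulVec A

@[simp]
theorem euclideanMulVecCLM_apply (x : EuclideanSpace ℝ (Fin n)) :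
    euclideanMulVecCLM A x = euclideanMulVec A x := rfl

end EuclideanMulVec

/-! ### Measurability and uniqueness of laws on path space -/

section PathSpace

variable {T : ℝ≥0} {N : ℕ}

theorem measurable_pathEval (t : Set.Icc (0 : ℝ≥0) T) :
    Measurable (pathEval t : PathSpace T N → EuclideanSpace ℝ (Fin N)) :=
  (continuous_eval_const t).measurable

instance : Nonempty (Set.Icc (0 : ℝ≥0) T) := ⟨⟨0, le_refl 0, bot_le⟩⟩

/-- The restriction of a function on `[0, T]` to a dense sequence of times. -/
noncomputable def denseRestrict (x : Set.Icc (0 : ℝ≥0) T → EuclideanSpace ℝ (Fin N)) (n : ℕ) :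
    EuclideanSpace ℝ (Fin N) :=
  x (TopologicalSpace.denseSeq (Set.Icc (0 : ℝ≥0) T) n)

theorem measurable_denseRestrict :
    Measurable (denseRestrict : (Set.Icc (0 : ℝ≥0) T → EuclideanSpace ℝ (Fin N)) → _) :=
  measurable_pi_lambda _ fun _ => measurable_pi_apply _

/-- A continuous path is determined by its values at countably many dense times, and an injective
measurable map out of a standard Borel space into a countable product is an embedding
(Lusin–Souslin). This links the Borel σ-algebra of uniform convergence to the coordinates. -/
theorem measurableEmbedding_denseRestrict_pathCoe :
    MeasurableEmbedding (fun w : PathSpace T N => denseRestrict (pathCoe w)) := by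
  refine Measurable.measurableEmbedding
    (measurable_denseRestrict.comp measurable_pathCoe) fun w w' h => ?_
  refine ContinuousMap.ext fun t => congrFun (Continuous.ext_on
    (TopologicalSpace.denseRange_denseSeq _) w.continuous w'.continuous ?_) t
  rintro _ ⟨n, rfl⟩
  exact congrFun h n

theorem measurable_toPathSpace {S : Type*} [MeasurableSpace S] {X : S → PathSpace T N}
    (h : ∀ t, Measurable fun ω => X ω t) : Measurable X :=
  measurableEmbedding_denseRestrict_pathCoe.measurable_comp_iff.1
    (measurable_pi_lambda _ fun _ => h _)

theorem indepFun_pathSpace_of_coe {S F : Type*} [MeasurableSpace S] [MeasurableSpace F]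
    {Pr : Measure S} {X : S → PathSpace T N} {Y : S → F}
    (h : IndepFun (fun ω => pathCoe (X ω)) Y Pr) : IndepFun X Y Pr := by
  -- `g` is a measurable left inverse of the embedding, so the path is a measurable function of its
  -- coordinates.
  obtain ⟨g, hg, hgX⟩ :=
    (measurableEmbedding_denseRestrict_pathCoe (T := T) (N := N)).exists_measurable_extend
      measurable_id fun _ => ⟨0⟩
  have hX : X = (g ∘ denseRestrict) ∘ fun ω => pathCoe (X ω) :=
    funext fun ω => (congrFun hgX (X ω)).symm
  rw [hX]
  exact h.comp (hg.comp measurable_denseRestrict) measurable_id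

/-- A process with almost surely continuous paths agrees almost surely on `[0, T]` with a random
element of path space. -/
theorem exists_measurable_path {S : Type*} [MeasurableSpace S] {Pr : Measure S}
    {W : ℝ≥0 → S → EuclideanSpace ℝ (Fin N)} (hW : ∀ t, Measurable (W t))
    (hc : ∀ᵐ ω ∂Pr, Continuous fun t => W t ω) (T : ℝ≥0) :
    ∃ X : S → PathSpace T N, Measurable X ∧
      ∀ᵐ ω ∂Pr, ∀ t : Set.Icc (0 : ℝ≥0) T, W t ω = X ω t := by
  classical
  obtain ⟨G, hG, hGm, hGc⟩ := hc.exists_measurable_mem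
  -- The zero path is used off a measurable set `G` of full measure, because the event of continuity
  -- itself need not be measurable.
  let X : S → PathSpace T N := fun ω =>
    if h : ω ∈ G then ⟨fun t => W t ω, (hGc ω h).comp continuous_subtype_val⟩ else 0
  have hX : ∀ t, (fun ω => X ω t) = G.indicator (W t) := by
    intro t
    ext1 ω
    by_cases h : ω ∈ G <;> simp [X, h]
  refine ⟨X, measurable_toPathSpace fun t => ?_, ?_⟩
  · rw [hX]
    exact (hW t).indicator hGm
  · filter_upwards [hG] with ω hω t
    rw [congrFun (hX t) ω, Set.indicator_of_mem hω]

/-- Two kernels into path space are almost everywhere equal if they induce the same joint law on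
the product space. -/
theorem ae_eq_of_compProd_map_pathCoe_eq {F : Type*} [MeasurableSpace F] {μ : Measure F}
    [IsFiniteMeasure μ] {κ η : Kernel F (PathSpace T N)} [IsFiniteKernel κ] [IsFiniteKernel η]
    (h : μ ⊗ₘ κ.map pathCoe = μ ⊗ₘ η.map pathCoe) : ∀ᵐ y ∂μ, κ y = η y := by
  have he := measurableEmbedding_denseRestrict_pathCoe (T := T) (N := N)
  have hmap (ρ : Kernel F (PathSpace T N)) [IsFiniteKernel ρ] :
      (μ ⊗ₘ ρ.map pathCoe).map (Prod.map id denseRestrict) =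
      μ ⊗ₘ ρ.map fun w => denseRestrict (pathCoe w) := by
    rw [← Measure.compProd_map measurable_denseRestrict,
      ← Kernel.map_comp_right _ measurable_pathCoe measurable_denseRestrict]
    rfl
  -- The comparison is made in the countable product, where a joint law determines the kernel almost
  -- everywhere; the embedding is then undone by `comap`.
  have h2 := congrArg (Measure.map (Prod.map id denseRestrict)) h
  rw [hmap, hmap] at h2
  filter_upwards [Kernel.compProd_eq_iff.1 h2] with y hy
  rw [Kernel.map_apply _ he.measurable, Kernel.map_apply _ he.measurable] at hy
  rw [← he.comap_map (κ y), hy, he.comap_map]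

end PathSpace

/-! ### Conditional law of an independent variable plus a function of the observation -/

section TranslateKernel

variable {S F E : Type*} [MeasurableSpace S] [MeasurableSpace F] [MeasurableSpace E] [AddCommGroup E]
  [MeasurableAdd₂ E] {h : F → E}

/-- The kernel `y ↦ law of (X + h y)`, where `X` has law `μ`. -/
noncomputable def translateKernel (μ : Measure E) (h : F → E) : Kernel F E :=
  (Kernel.id ×ₖ Kernel.const F μ).map fun p => p.2 + h p.1

theorem isMarkovKernel_translateKernel (μ : Measure E) [IsProbabilityMeasure μ]
    (hh : Measurable h) : IsMarkovKernel (translateKernel μ h) :=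
  Kernel.IsMarkovKernel.map _ (measurable_snd.add (hh.comp measurable_fst))

theorem translateKernel_apply (μ : Measure E) [IsProbabilityMeasure μ] (hh : Measurable h) (y : F) :
    translateKernel μ h y = μ.map (fun x => x + h y) := by
  have hm : Measurable fun p : F × E => p.2 + h p.1 :=
    measurable_snd.add (hh.comp measurable_fst)
  rw [translateKernel, Kernel.map_apply _ hm, Kernel.prod_apply, Kernel.id_apply,
    Kernel.const_apply, Measure.dirac_prod, Measure.map_map hm measurable_prodMk_left]
  rfl

/-- By independence (Y, X) has a product law, and the shear (y, x) ↦ (y, x + h y) turns it into the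
composition product with the translation kernel. -/
theorem hasCondDistrib_translateKernel {Pr : Measure S} [IsProbabilityMeasure Pr] {X : S → E}
    {Y : S → F} (hX : Measurable X) (hY : Measurable Y) (hh : Measurable h)
    (hXY : IndepFun X Y Pr) :
    HasCondDistrib (fun ω => X ω + h (Y ω)) Y (translateKernel (Pr.map X) h) Pr := by
  have := Measure.isProbabilityMeasure_map (μ := Pr) hX.aemeasurable
  have := Measure.isProbabilityMeasure_map (μ := Pr) hY.aemeasurable
  have := isMarkovKernel_translateKernel (Pr.map X) hh
  have hm : Measurable fun p : F × E => (p.1, p.2 + h p.1) :=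
    measurable_fst.prodMk (measurable_snd.add (hh.comp measurable_fst))
  refine ⟨(hY.prodMk (hX.add (hh.comp hY))).aemeasurable, ?_⟩
  have h1 : Pr.map (fun ω => (Y ω, X ω + h (Y ω))) =
      ((Pr.map Y).prod (Pr.map X)).map fun p : F × E => (p.1, p.2 + h p.1) := by
    rw [← (indepFun_iff_map_prod_eq_prod_map_map hY.aemeasurable hX.aemeasurable).1 hXY.symm,
      Measure.map_map hm (hY.prodMk hX)]
    rfl
  rw [h1]
  ext s hs
  rw [Measure.map_apply hm hs, Measure.prod_apply (hm hs), Measure.compProd_apply hs]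
  refine lintegral_congr fun y => ?_
  rw [translateKernel_apply _ hh, Measure.map_apply (by fun_prop) (measurable_prodMk_left hs)]
  rfl

end TranslateKernel

/-! ### Weakly continuous kernels -/

section WeakContinuity

/-- Dominated convergence applied to f(x + h y), which is bounded by ‖f‖ and continuous in y. -/
theorem isWeaklyContinuousKernel_translateKernel {F E : Type*} [TopologicalSpace F]
    [FirstCountableTopology F] [MeasurableSpace F] [AddCommGroup E] [TopologicalSpace E]
    [ContinuousAdd E] [MeasurableSpace E] [BorelSpace E] [MeasurableAdd₂ E] (μ : Measure E)
    [IsProbabilityMeasure μ] {h : F → E} (hm : Measurable h) (hc : Continuous h) :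
    IsWeaklyContinuousKernel (translateKernel μ h) := by
  intro f
  have heq (y : F) : ∫ x, f x ∂(translateKernel μ h y) = ∫ x, f (x + h y) ∂μ := by
    rw [translateKernel_apply _ hm, integral_map (by fun_prop)
      f.continuous.measurable.stronglyMeasurable.aestronglyMeasurable]
  simp_rw [heq]
  refine continuous_of_dominated (bound := fun _ => ‖f‖) (fun y => ?_)
    (fun y => .of_forall fun x => f.norm_coe_le_norm _) (integrable_const _)
    (.of_forall fun x => by fun_prop)
  exact (f.continuous.measurable.comp (measurable_add_const _)).stronglyMeasurable.aestronglyMeasurable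

/-- Weakly continuous Markov kernels which agree almost everywhere for a measure of full support
agree everywhere. -/
theorem IsWeaklyContinuousKernel.eq_of_ae_eq {F E : Type*} [TopologicalSpace F] [MeasurableSpace F]
    [TopologicalSpace E] [HasOuterApproxClosed E] [MeasurableSpace E] [BorelSpace E]
    {μ : Measure F} [μ.IsOpenPosMeasure] {κ η : Kernel F E} [IsMarkovKernel κ] [IsMarkovKernel η]
    (hκ : IsWeaklyContinuousKernel κ) (hη : IsWeaklyContinuousKernel η)
    (h : ∀ᵐ y ∂μ, κ y = η y) (y : F) : κ y = η y := by
  refine ext_of_forall_integral_eq_of_IsFiniteMeasure fun f => ?_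
  refine congrFun (Continuous.ext_on (Measure.dense_of_ae h) (hκ f) (hη f) fun y hy => ?_) y
  rw [Set.mem_ofPred_eq] at hy
  simp only [hy]

end WeakContinuity

/-! ### Full support of nondegenerate Gaussian laws and of sums -/

section FullSupport

open scoped MatrixOrder

instance isOpenPosMeasure_stdGaussian {E : Type*} [NormedAddCommGroup E] [InnerProductSpace ℝ E]
    [FiniteDimensional ℝ E] [MeasurableSpace E] [BorelSpace E] :
    (stdGaussian E).IsOpenPosMeasure := by
  have : (gaussianReal 0 1).IsOpenPosMeasure :=
    (gaussianReal_absolutelyContinuous' 0 one_ne_zero).isOpenPosMeasure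
  rw [stdGaussian]
  refine Continuous.isOpenPosMeasure_map (by fun_prop) fun x => ?_
  exact ⟨(stdOrthonormalBasis ℝ E).repr x, (stdOrthonormalBasis ℝ E).sum_repr x⟩

/-- The law is the image of the standard Gaussian under x ↦ μ + √A x, which is onto because √A is
invertible. -/
theorem isOpenPosMeasure_multivariateGaussian {ι : Type*} [Fintype ι] [DecidableEq ι]
    (μ : EuclideanSpace ℝ ι) {A : Matrix ι ι ℝ} (hA : A.PosDef) :
    (multivariateGaussian μ A).IsOpenPosMeasure := by
  rw [multivariateGaussian]
  refine Continuous.isOpenPosMeasure_map (by fun_prop) fun x => ?_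
  have hunit : IsUnit (CFC.sqrt A) := by
    have h := hA.isUnit
    rw [← CFC.sqrt_mul_sqrt_self A hA.posSemidef.nonneg, Matrix.isUnit_iff_isUnit_det,
      Matrix.det_mul] at h
    exact (Matrix.isUnit_iff_isUnit_det _).2 (isUnit_of_mul_isUnit_left h)
  obtain ⟨z, hz⟩ := Matrix.mulVec_surjective_iff_isUnit.2 hunit (WithLp.ofLp (x - μ))
  refine ⟨WithLp.toLp 2 z, ?_⟩
  ext i
  simp [hz]

/-- By Fubini, if X + Y avoids an open set U almost surely, then Y avoids the open translate U - x
for almost every x, which forces U to be empty. -/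
theorem ProbabilityTheory.IndepFun.isOpenPosMeasure_map_add {S F : Type*} [MeasurableSpace S] [NormedAddCommGroup F]
    [SecondCountableTopology F] [MeasurableSpace F] [BorelSpace F] {Pr : Measure S}
    [IsProbabilityMeasure Pr] {X Y : S → F} (hX : Measurable X) (hY : Measurable Y)
    (hXY : IndepFun X Y Pr) [(Pr.map Y).IsOpenPosMeasure] :
    (Pr.map fun ω => X ω + Y ω).IsOpenPosMeasure := by
  have := Measure.isProbabilityMeasure_map (μ := Pr) hX.aemeasurable
  have := Measure.isProbabilityMeasure_map (μ := Pr) hY.aemeasurable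
  refine ⟨fun U hU hne h0 => ?_⟩
  have hm : Measurable fun p : F × F => p.1 + p.2 := measurable_add
  have h1 : Pr.map (fun ω => X ω + Y ω) =
      ((Pr.map X).prod (Pr.map Y)).map fun p : F × F => p.1 + p.2 := by
    rw [← (indepFun_iff_map_prod_eq_prod_map_map hX.aemeasurable hY.aemeasurable).1 hXY,
      Measure.map_map hm (hX.prodMk hY)]
    rfl
  rw [h1, Measure.map_apply hm hU.measurableSet,
    Measure.measure_prod_null (hm hU.measurableSet)] at h0
  obtain ⟨x, hx⟩ := h0.exists
  obtain ⟨u, hu⟩ := hne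
  refine (IsOpen.measure_ne_zero _ (hU.preimage (continuous_const.add continuous_id)) ?_) hx
  exact ⟨u - x, by simpa using hu⟩

end FullSupport

/-! ### Gaussian processes built linearly from jointly Gaussian data -/

section JointlyGaussian

variable {S D A E F G : Type*} [MeasurableSpace S] {Pr : Measure S}
  [NormedAddCommGroup E] [NormedSpace ℝ E] [MeasurableSpace E] [BorelSpace E]
  [SecondCountableTopology E]
  [NormedAddCommGroup F] [NormedSpace ℝ F] [MeasurableSpace F] [BorelSpace F]
  [SecondCountableTopology F]
  [NormedAddCommGroup G] [NormedSpace ℝ G] [MeasurableSpace G] [BorelSpace G]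
  [SecondCountableTopology G] {V : D → S → E} {ε : S → F}

/-- A process each of whose values is a continuous linear function of finitely many values of
`V` and of `ε`, where `V` and `ε` are jointly Gaussian, is Gaussian. -/
theorem isGaussianProcess_of_restrict_prod
    (h : ∀ I : Finset D, HasGaussianLaw (fun ω => (I.restrict (V · ω), ε ω)) Pr)
    {R : A → S → G}
    (hR : ∀ a, ∃ I : Finset D, ∃ Λ : ((I → E) × F) →L[ℝ] G,
      ∀ ω, R a ω = Λ (I.restrict (V · ω), ε ω)) :
    IsGaussianProcess R Pr where
  hasGaussianLaw J := by
    choose I Λ hΛ using hR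
    classical
    let M : ((J.biUnion I → E) × F) →L[ℝ] (J → G) :=
      { toFun := fun p a => Λ a (fun t => p.1 ⟨t.1, Finset.mem_biUnion.2 ⟨a.1, a.2, t.2⟩⟩, p.2)
        map_add' := fun p q => by ext a; simp [← map_add, ← Pi.add_def]
        map_smul' := fun c p => by ext a; simp [← map_smul, ← Pi.smul_def]
        cont := by fun_prop }
    have : (fun ω => J.restrict (R · ω)) = M ∘ fun ω => ((J.biUnion I).restrict (V · ω), ε ω) := by
      ext ω a
      simp [M, hΛ, Finset.restrict_def]
    rw [this]
    exact (h _).map M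

theorem ProbabilityTheory.IndepFun.hasGaussianLaw_restrict_prod [CompleteSpace E] [CompleteSpace F]
    (hV : IsGaussianProcess V Pr) (hε : HasGaussianLaw ε Pr)
    (hind : IndepFun (fun ω t => V t ω) ε Pr) (I : Finset D) :
    HasGaussianLaw (fun ω => (I.restrict (V · ω), ε ω)) Pr :=
  IndepFun.hasGaussianLaw (hV.hasGaussianLaw I) hε
    (hind.comp (Finset.measurable_restrict I) measurable_id)

/-- Adding a deterministic function to a Gaussian process. -/
theorem ProbabilityTheory.IsGaussianProcess.add_const {X : D → S → E} (hX : IsGaussianProcess X Pr) (c : D → E) :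
    IsGaussianProcess (fun t ω => X t ω + c t) Pr where
  hasGaussianLaw I := by
    have hI := hX.hasGaussianLaw I
    have := hI.isGaussian_map
    have hm : AEMeasurable (fun ω => I.restrict (X · ω)) Pr := hI.aemeasurable
    refine ⟨?_⟩
    have heq : Pr.map (fun ω => I.restrict fun t => X t ω + c t) =
        (Pr.map fun ω => I.restrict (X · ω)).map (fun x => x + I.restrict c) := by
      rw [AEMeasurable.map_map_of_aemeasurable (measurable_add_const _).aemeasurable hm]
      rfl
    rw [heq]
    infer_instance

end JointlyGaussian

/-! ### Gaussianity and covariance of the Brownian increments from time 0 -/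

section Brownian

variable {S : Type*} [MeasurableSpace S] {Pr : Measure S} {N : ℕ}
  {a : EuclideanSpace ℝ (Fin N)} {Sig : Matrix (Fin N) (Fin N) ℝ}
  {W : ℝ≥0 → S → EuclideanSpace ℝ (Fin N)}

theorem IsCorrelatedBrownianMotion.hasLaw_sub_zero (hW : IsCorrelatedBrownianMotion a Sig W Pr)
    (t : ℝ≥0) : HasLaw (fun ω => W t ω - W 0 ω) (multivariateGaussian 0 ((t : ℝ) • Sig)) Pr := by
  simpa using hW.law_increment 0 t bot_le

theorem IsCorrelatedBrownianMotion.hasIndepIncrements_sub_zero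
    (hW : IsCorrelatedBrownianMotion a Sig W Pr) :
    HasIndepIncrements (fun t ω => W t ω - W 0 ω) Pr := by
  intro n t ht
  simpa using hW.indep_increments n t ht

/-- Subtracting W(0) rather than a makes the process vanish at time 0 for every ω. -/
theorem IsCorrelatedBrownianMotion.isGaussianProcess_sub_zero
    (hW : IsCorrelatedBrownianMotion a Sig W Pr) :
    IsGaussianProcess (fun t ω => W t ω - W 0 ω) Pr :=
  hW.hasIndepIncrements_sub_zero.isGaussianProcess (fun t => (hW.hasLaw_sub_zero t).hasGaussianLaw)
    (.of_forall fun _ => sub_self _)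

/-- A linear functional of a Euclidean random vector with Gaussian law is square integrable. -/
theorem ProbabilityTheory.HasGaussianLaw.memLp_dotProduct {n : ℕ} {X : S → EuclideanSpace ℝ (Fin n)}
    (hX : HasGaussianLaw X Pr) (u : Fin n → ℝ) :
    MemLp (fun ω => u ⬝ᵥ WithLp.ofLp (X ω)) 2 Pr := by
  have h := (hX.map_fun (innerSL ℝ (WithLp.toLp 2 u))).memLp_two
  convert h using 2 with ω
  simp [PiLp.inner_apply, dotProduct, mul_comm]

theorem ProbabilityTheory.HasLaw.covariance_dotProduct {n : ℕ} {X : S → EuclideanSpace ℝ (Fin n)}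
    {A : Matrix (Fin n) (Fin n) ℝ} (hA : A.PosSemidef)
    (hX : HasLaw X (multivariateGaussian 0 A) Pr) (u v : Fin n → ℝ) :
    cov[fun ω => u ⬝ᵥ WithLp.ofLp (X ω), fun ω => v ⬝ᵥ WithLp.ofLp (X ω); Pr] = u ⬝ᵥ A *ᵥ v := by
  have h := covarianceBilin_multivariateGaussian (μ := 0) hA (WithLp.toLp 2 u) (WithLp.toLp 2 v)
  rw [covarianceBilin_apply_eq_cov IsGaussian.memLp_two_id] at h
  rw [← h, ← hX.covariance_fun_comp (by fun_prop) (by fun_prop)]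
  simp [PiLp.inner_apply, dotProduct, mul_comm]

theorem IsCorrelatedBrownianMotion.covariance_dotProduct [IsProbabilityMeasure Pr]
    (hW : IsCorrelatedBrownianMotion a Sig W Pr) (hSig : Sig.PosSemidef) (s t : ℝ≥0)
    (u v : Fin N → ℝ) :
    cov[fun ω => u ⬝ᵥ WithLp.ofLp (W s ω - W 0 ω), fun ω => v ⬝ᵥ WithLp.ofLp (W t ω - W 0 ω); Pr]
      = (min (s : ℝ) t) * (u ⬝ᵥ Sig *ᵥ v) := by
  wlog hst : s ≤ t generalizing s t u v
  · have hsymm : Sigᵀ = Sig := by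
      rw [← Matrix.conjTranspose_eq_transpose_of_trivial]; exact hSig.isHermitian
    rw [covariance_comm, this t s v u (le_of_not_ge hst), min_comm, Matrix.dotProduct_mulVec,
      ← Matrix.mulVec_transpose, hsymm, dotProduct_comm]
  have hg (r : ℝ≥0) : HasGaussianLaw (fun ω => W r ω - W 0 ω) Pr :=
    (hW.hasLaw_sub_zero r).hasGaussianLaw
  have hg' : HasGaussianLaw (fun ω => W t ω - W s ω) Pr := (hW.law_increment s t hst).hasGaussianLaw
  -- The path is split at time s: the later increment is independent of W(s) - W(0), so only the
  -- covariance at time s survives.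
  have hsplit : (fun ω => v ⬝ᵥ WithLp.ofLp (W t ω - W 0 ω)) =
      (fun ω => v ⬝ᵥ WithLp.ofLp (W s ω - W 0 ω)) + fun ω => v ⬝ᵥ WithLp.ofLp (W t ω - W s ω) := by
    ext ω
    simp only [Pi.add_apply, ← dotProduct_add, ← WithLp.ofLp_add]
    congr 2
    abel
  have hind : IndepFun (fun ω => W s ω - W 0 ω) (fun ω => W t ω - W s ω) Pr :=
    hW.indep_increments.indepFun_sub_sub bot_le hst
  have hmd (w : Fin N → ℝ) :
      Measurable fun x : EuclideanSpace ℝ (Fin N) => w ⬝ᵥ WithLp.ofLp x :=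
    (by fun_prop : Continuous fun x : EuclideanSpace ℝ (Fin N) =>
      w ⬝ᵥ WithLp.ofLp x).measurable
  have h0 : cov[fun ω => u ⬝ᵥ WithLp.ofLp (W s ω - W 0 ω),
      fun ω => v ⬝ᵥ WithLp.ofLp (W t ω - W s ω); Pr] = 0 :=
    (hind.comp (hmd u) (hmd v)).covariance_eq_zero
      ((hg s).memLp_dotProduct u) (hg'.memLp_dotProduct v)
  rw [hsplit, covariance_add_right ((hg s).memLp_dotProduct u) ((hg s).memLp_dotProduct v)
    (hg'.memLp_dotProduct v), (hW.hasLaw_sub_zero s).covariance_dotProduct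
    (hSig.smul s.coe_nonneg), h0, min_eq_left (NNReal.coe_le_coe.2 hst),
    Matrix.smul_mulVec, dotProduct_smul, add_zero, smul_eq_mul]

end Brownian

/-! ### The regression residual and its independence from the observation -/

section Residual

theorem transpose_mulVec_dotProduct {m n : ℕ} (A : Matrix (Fin m) (Fin n) ℝ) (u : Fin m → ℝ)
    (x : Fin n → ℝ) : (Aᵀ *ᵥ u) ⬝ᵥ x = u ⬝ᵥ A *ᵥ x := by
  rw [Matrix.mulVec_transpose, Matrix.dotProduct_mulVec]

theorem covariance_add_add {S : Type*} [MeasurableSpace S] {Pr : Measure S} [IsFiniteMeasure Pr]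
    {f₁ f₂ g₁ g₂ : S → ℝ} (hf₁ : MemLp f₁ 2 Pr) (hf₂ : MemLp f₂ 2 Pr) (hg₁ : MemLp g₁ 2 Pr)
    (hg₂ : MemLp g₂ 2 Pr) :
    cov[f₁ + f₂, g₁ + g₂; Pr] =
      cov[f₁, g₁; Pr] + cov[f₁, g₂; Pr] + (cov[f₂, g₁; Pr] + cov[f₂, g₂; Pr]) := by
  rw [covariance_add_left hf₁ hf₂ (hg₁.add hg₂), covariance_add_right hf₁ hg₁ hg₂,
    covariance_add_right hf₂ hg₁ hg₂]

variable {S : Type*} [MeasurableSpace S] {Pr : Measure S} [IsProbabilityMeasure Pr]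
  {N K : ℕ} {T : ℝ≥0} {a : EuclideanSpace ℝ (Fin N)} {Sig : Matrix (Fin N) (Fin N) ℝ}
  {P : Matrix (Fin K) (Fin N) ℝ} {Om : Matrix (Fin K) (Fin K) ℝ}
  {W : ℝ≥0 → S → EuclideanSpace ℝ (Fin N)} {ε : S → EuclideanSpace ℝ (Fin K)}

/-- The centered observation `P (W T - W 0) + ε`. -/
noncomputable def centeredView (T : ℝ≥0) (P : Matrix (Fin K) (Fin N) ℝ)
    (W : ℝ≥0 → S → EuclideanSpace ℝ (Fin N)) (ε : S → EuclideanSpace ℝ (Fin K)) (ω : S) :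
    EuclideanSpace ℝ (Fin K) :=
  euclideanMulVec P (W T ω - W 0 ω) + ε ω

/-- The residual of `W t - W 0` after linear regression on the observation. -/
noncomputable def bridgeResidual (T : ℝ≥0) (Sig : Matrix (Fin N) (Fin N) ℝ)
    (P : Matrix (Fin K) (Fin N) ℝ) (Om : Matrix (Fin K) (Fin K) ℝ)
    (W : ℝ≥0 → S → EuclideanSpace ℝ (Fin N)) (ε : S → EuclideanSpace ℝ (Fin K))
    (t : Set.Icc (0 : ℝ≥0) T) (ω : S) : EuclideanSpace ℝ (Fin N) :=
  (W t ω - W 0 ω) -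
    ((t : ℝ≥0) : ℝ) • euclideanMulVec (betaOne T Sig P Om) (centeredView T P W ε ω)

omit [IsProbabilityMeasure Pr] in
theorem indepFun_increments_of_indepFun
    (h_indep : IndepFun (fun ω (t : Set.Icc (0 : ℝ≥0) T) => W t ω) ε Pr) :
    IndepFun (fun ω (t : Set.Icc (0 : ℝ≥0) T) => W t ω - W 0 ω) ε Pr := by
  have hm : Measurable fun (x : Set.Icc (0 : ℝ≥0) T → EuclideanSpace ℝ (Fin N))
      (t : Set.Icc (0 : ℝ≥0) T) => x t - x ⟨0, le_refl 0, bot_le⟩ := by fun_prop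
  exact h_indep.comp hm measurable_id

/-- Residual and centered observation are both linear in W(s) - W(0), W(T) - W(0) and ε, so this one
bilinear formula serves every covariance below. -/
theorem covariance_dotProduct_increments_add_noise
    (hW : IsCorrelatedBrownianMotion a Sig W Pr) (hSig : Sig.PosSemidef) (hOm : Om.PosSemidef)
    (hε : HasLaw ε (multivariateGaussian 0 ((T : ℝ) • Om)) Pr)
    (h_indep : IndepFun (fun ω (t : Set.Icc (0 : ℝ≥0) T) => W t ω) ε Pr)
    (s r : Set.Icc (0 : ℝ≥0) T) (u u' v v' : Fin N → ℝ) (p q : Fin K → ℝ) :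
    cov[((fun ω => u ⬝ᵥ WithLp.ofLp (W s ω - W 0 ω)) +
          fun ω => u' ⬝ᵥ WithLp.ofLp (W T ω - W 0 ω)) + fun ω => p ⬝ᵥ WithLp.ofLp (ε ω),
        ((fun ω => v ⬝ᵥ WithLp.ofLp (W r ω - W 0 ω)) +
          fun ω => v' ⬝ᵥ WithLp.ofLp (W T ω - W 0 ω)) + fun ω => q ⬝ᵥ WithLp.ofLp (ε ω); Pr] =
      min (s : ℝ) (r : ℝ) * (u ⬝ᵥ Sig *ᵥ v) + (s : ℝ) * (u ⬝ᵥ Sig *ᵥ v') +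
        (r : ℝ) * (u' ⬝ᵥ Sig *ᵥ v) + (T : ℝ) * (u' ⬝ᵥ Sig *ᵥ v') + (T : ℝ) * (p ⬝ᵥ Om *ᵥ q) := by
  have hV (t : ℝ≥0) (w : Fin N → ℝ) :
      MemLp (fun ω => w ⬝ᵥ WithLp.ofLp (W t ω - W 0 ω)) 2 Pr :=
    (hW.hasLaw_sub_zero t).hasGaussianLaw.memLp_dotProduct w
  have hE (w : Fin K → ℝ) : MemLp (fun ω => w ⬝ᵥ WithLp.ofLp (ε ω)) 2 Pr :=
    hε.hasGaussianLaw.memLp_dotProduct w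
  have hmd {n : ℕ} (w : Fin n → ℝ) :
      Measurable fun x : EuclideanSpace ℝ (Fin n) => w ⬝ᵥ WithLp.ofLp x :=
    (by fun_prop : Continuous fun x : EuclideanSpace ℝ (Fin n) =>
      w ⬝ᵥ WithLp.ofLp x).measurable
  have hVE (t : Set.Icc (0 : ℝ≥0) T) (w : Fin N → ℝ) (z : Fin K → ℝ) :
      cov[fun ω => w ⬝ᵥ WithLp.ofLp (W t ω - W 0 ω), fun ω => z ⬝ᵥ WithLp.ofLp (ε ω); Pr] = 0 :=
    ((indepFun_increments_of_indepFun h_indep).comp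
      ((hmd w).comp (measurable_pi_apply t)) (hmd z)).covariance_eq_zero (hV t w) (hE z)
  have hEV (t : Set.Icc (0 : ℝ≥0) T) (w : Fin N → ℝ) (z : Fin K → ℝ) :
      cov[fun ω => z ⬝ᵥ WithLp.ofLp (ε ω), fun ω => w ⬝ᵥ WithLp.ofLp (W t ω - W 0 ω); Pr] = 0 := by
    rw [covariance_comm, hVE]
  have hTm : T ∈ Set.Icc (0 : ℝ≥0) T := ⟨bot_le, le_refl T⟩
  have hs : (s : ℝ) ≤ T := NNReal.coe_le_coe.2 s.2.2
  have hr : (r : ℝ) ≤ T := NNReal.coe_le_coe.2 r.2.2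
  rw [covariance_add_add ((hV _ _).add (hV _ _)) (hE _) ((hV _ _).add (hV _ _)) (hE _),
    covariance_add_add (hV _ _) (hV _ _) (hV _ _) (hV _ _),
    covariance_add_left (hV _ _) (hV _ _) (hE _), covariance_add_right (hE _) (hV _ _) (hV _ _),
    hVE, hVE ⟨T, hTm⟩, hEV, hEV ⟨T, hTm⟩, hε.covariance_dotProduct (hOm.smul T.coe_nonneg)]
  simp only [hW.covariance_dotProduct hSig]
  rw [min_eq_left hs, min_eq_right hr, min_self, Matrix.smul_mulVec, dotProduct_smul, smul_eq_mul]
  ring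

omit [MeasurableSpace S] in
theorem dotProduct_bridgeResidual (t : Set.Icc (0 : ℝ≥0) T) (u : Fin N → ℝ) :
    (fun ω => u ⬝ᵥ WithLp.ofLp (bridgeResidual T Sig P Om W ε t ω)) =
      ((fun ω => u ⬝ᵥ WithLp.ofLp (W t ω - W 0 ω)) +
        fun ω => (-(t : ℝ) • ((betaOne T Sig P Om * P)ᵀ *ᵥ u)) ⬝ᵥ WithLp.ofLp (W T ω - W 0 ω)) +
        fun ω => (-(t : ℝ) • ((betaOne T Sig P Om)ᵀ *ᵥ u)) ⬝ᵥ WithLp.ofLp (ε ω) := by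
  ext ω
  simp only [bridgeResidual, centeredView, euclideanMulVec, Pi.add_apply, smul_dotProduct,
    transpose_mulVec_dotProduct, WithLp.ofLp_sub, WithLp.ofLp_smul, WithLp.ofLp_add,
    Matrix.mulVec_add, dotProduct_sub, dotProduct_smul, dotProduct_add, Matrix.mulVec_mulVec,
    smul_eq_mul, Matrix.mulVec_sub]
  ring

omit [MeasurableSpace S] in
theorem dotProduct_centeredView (t : Set.Icc (0 : ℝ≥0) T) (w : Fin K → ℝ) :
    (fun ω => w ⬝ᵥ WithLp.ofLp (centeredView T P W ε ω)) =
      ((fun ω => (0 : Fin N → ℝ) ⬝ᵥ WithLp.ofLp (W t ω - W 0 ω)) +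
        fun ω => (Pᵀ *ᵥ w) ⬝ᵥ WithLp.ofLp (W T ω - W 0 ω)) +
        fun ω => w ⬝ᵥ WithLp.ofLp (ε ω) := by
  ext ω
  simp [centeredView, euclideanMulVec, transpose_mulVec_dotProduct, Matrix.mulVec_sub]

theorem covariance_bridgeResidual_centeredView (hT : 0 < T)
    (hW : IsCorrelatedBrownianMotion a Sig W Pr) (hSig : Sig.PosDef) (hOm : Om.PosDef)
    (hε : HasLaw ε (multivariateGaussian 0 ((T : ℝ) • Om)) Pr)
    (h_indep : IndepFun (fun ω (t : Set.Icc (0 : ℝ≥0) T) => W t ω) ε Pr)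
    (t : Set.Icc (0 : ℝ≥0) T) (u : Fin N → ℝ) (w : Fin K → ℝ) :
    cov[fun ω => u ⬝ᵥ WithLp.ofLp (bridgeResidual T Sig P Om W ε t ω),
      fun ω => w ⬝ᵥ WithLp.ofLp (centeredView T P W ε ω); Pr] = 0 := by
  have h := congrArg (fun A => u ⬝ᵥ A *ᵥ w)
    (betaOne_mul_observation_cov (Sig := Sig) (P := P) hT hSig hOm)
  rw [dotProduct_bridgeResidual, dotProduct_centeredView t,
    covariance_dotProduct_increments_add_noise hW hSig.posSemidef hOm.posSemidef hε h_indep]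
  simp only [Matrix.mulVec_zero, dotProduct_zero, mul_zero, zero_add, smul_dotProduct,
    transpose_mulVec_dotProduct, Matrix.mulVec_mulVec, smul_eq_mul, Matrix.smul_mulVec,
    Matrix.mul_add, Matrix.add_mulVec, dotProduct_smul, dotProduct_add, Matrix.mul_assoc] at h ⊢
  linear_combination (-(t : ℝ)) * h

theorem covariance_bridgeResidual (hT : 0 < T)
    (hW : IsCorrelatedBrownianMotion a Sig W Pr) (hSig : Sig.PosDef) (hOm : Om.PosDef)
    (hε : HasLaw ε (multivariateGaussian 0 ((T : ℝ) • Om)) Pr)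
    (h_indep : IndepFun (fun ω (t : Set.Icc (0 : ℝ≥0) T) => W t ω) ε Pr)
    (t s : Set.Icc (0 : ℝ≥0) T) (u v : Fin N → ℝ) :
    cov[fun ω => u ⬝ᵥ WithLp.ofLp (bridgeResidual T Sig P Om W ε t ω),
      fun ω => v ⬝ᵥ WithLp.ofLp (bridgeResidual T Sig P Om W ε s ω); Pr] =
      u ⬝ᵥ ((min (s : ℝ) (t : ℝ)) • Sig - ((s : ℝ) * t) • (betaOne T Sig P Om * P * Sig)) *ᵥ v := by
  have h := congrArg (fun A => u ⬝ᵥ (A * (betaOne T Sig P Om)ᵀ) *ᵥ v)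
    (betaOne_mul_observation_cov (Sig := Sig) (P := P) hT hSig hOm)
  rw [dotProduct_bridgeResidual, dotProduct_bridgeResidual,
    covariance_dotProduct_increments_add_noise hW hSig.posSemidef hOm.posSemidef hε h_indep,
    min_comm]
  simp only [smul_dotProduct, transpose_mulVec_dotProduct]
  simp only [Matrix.mulVec_mulVec, smul_eq_mul,
    Matrix.smul_mulVec, Matrix.mulVec_smul, Matrix.smul_mul, Matrix.add_mul, Matrix.sub_mulVec,
    Matrix.mul_add, Matrix.add_mulVec, dotProduct_smul, dotProduct_add, dotProduct_sub,
    Matrix.mul_assoc, Matrix.transpose_mul] at h ⊢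
  -- The normal equation times β₁ᵀ turns the variance term tsT·β₁(PΣPᵀ + Ω)β₁ᵀ into tsΣPᵀβ₁ᵀ. This
  -- cancels one of the two cross terms and leaves -tsβ₁PΣ.
  linear_combination (t : ℝ) * s * h

omit [IsProbabilityMeasure Pr] in
theorem hasGaussianLaw_increments_noise (hW : IsCorrelatedBrownianMotion a Sig W Pr)
    (hε : HasLaw ε (multivariateGaussian 0 ((T : ℝ) • Om)) Pr)
    (h_indep : IndepFun (fun ω (t : Set.Icc (0 : ℝ≥0) T) => W t ω) ε Pr)
    (I : Finset (Set.Icc (0 : ℝ≥0) T)) :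
    HasGaussianLaw (fun ω => (I.restrict fun t => W t ω - W 0 ω, ε ω)) Pr :=
  (indepFun_increments_of_indepFun h_indep).hasGaussianLaw_restrict_prod
    (V := fun (t : Set.Icc (0 : ℝ≥0) T) ω => W t ω - W 0 ω)
    (hW.isGaussianProcess_sub_zero.restrict _) hε.hasGaussianLaw I

omit [MeasurableSpace S] in
theorem exists_centeredView_eq_clm (T : ℝ≥0) (P : Matrix (Fin K) (Fin N) ℝ)
    (W : ℝ≥0 → S → EuclideanSpace ℝ (Fin N)) (ε : S → EuclideanSpace ℝ (Fin K))
    (I : Finset (Set.Icc (0 : ℝ≥0) T)) (hI : ⟨T, bot_le, le_refl T⟩ ∈ I) :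
    ∃ Λ : ((I → EuclideanSpace ℝ (Fin N)) × EuclideanSpace ℝ (Fin K)) →L[ℝ]
        EuclideanSpace ℝ (Fin K),
      ∀ ω, centeredView T P W ε ω = Λ (I.restrict fun t => W t ω - W 0 ω, ε ω) :=
  ⟨(euclideanMulVecCLM P ∘L ContinuousLinearMap.proj ⟨_, hI⟩ ∘L ContinuousLinearMap.fst ℝ _ _) +
    ContinuousLinearMap.snd ℝ _ _, fun ω => by simp [centeredView]⟩

omit [MeasurableSpace S] in
theorem exists_bridgeResidual_eq_clm (T : ℝ≥0) (Sig : Matrix (Fin N) (Fin N) ℝ)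
    (P : Matrix (Fin K) (Fin N) ℝ) (Om : Matrix (Fin K) (Fin K) ℝ)
    (W : ℝ≥0 → S → EuclideanSpace ℝ (Fin N)) (ε : S → EuclideanSpace ℝ (Fin K))
    (t : Set.Icc (0 : ℝ≥0) T) :
    ∃ I : Finset (Set.Icc (0 : ℝ≥0) T),
      ∃ Λ : ((I → EuclideanSpace ℝ (Fin N)) × EuclideanSpace ℝ (Fin K)) →L[ℝ]
        EuclideanSpace ℝ (Fin N),
      ∀ ω, bridgeResidual T Sig P Om W ε t ω = Λ (I.restrict fun t => W t ω - W 0 ω, ε ω) := by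
  classical
  obtain ⟨Λ, hΛ⟩ := exists_centeredView_eq_clm T P W ε {t, ⟨T, bot_le, le_refl T⟩} (by simp)
  refine ⟨_, (ContinuousLinearMap.proj ⟨t, by simp⟩ ∘L ContinuousLinearMap.fst ℝ _ _) -
    (t : ℝ) • (euclideanMulVecCLM (betaOne T Sig P Om) ∘L Λ), fun ω => ?_⟩
  simp [bridgeResidual, hΛ]

omit [IsProbabilityMeasure Pr] in
theorem isGaussianProcess_bridgeResidual (hW : IsCorrelatedBrownianMotion a Sig W Pr)
    (hε : HasLaw ε (multivariateGaussian 0 ((T : ℝ) • Om)) Pr)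
    (h_indep : IndepFun (fun ω (t : Set.Icc (0 : ℝ≥0) T) => W t ω) ε Pr) :
    IsGaussianProcess (bridgeResidual T Sig P Om W ε) Pr :=
  isGaussianProcess_of_restrict_prod (hasGaussianLaw_increments_noise hW hε h_indep)
    (exists_bridgeResidual_eq_clm T Sig P Om W ε)

theorem indepFun_bridgeResidual_centeredView (hT : 0 < T)
    (hW : IsCorrelatedBrownianMotion a Sig W Pr) (hSig : Sig.PosDef) (hOm : Om.PosDef)
    (hε : HasLaw ε (multivariateGaussian 0 ((T : ℝ) • Om)) Pr)
    (h_indep : IndepFun (fun ω (t : Set.Icc (0 : ℝ≥0) T) => W t ω) ε Pr) :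
    IndepFun (fun ω t => bridgeResidual T Sig P Om W ε t ω) (centeredView T P W ε) Pr := by
  let X : Set.Icc (0 : ℝ≥0) T × Fin N → S → ℝ :=
    fun p ω => bridgeResidual T Sig P Om W ε p.1 ω p.2
  let Z : Fin K → S → ℝ := fun k ω => centeredView T P W ε ω k
  -- All scalar coordinates of residual and observation form one Gaussian family, in which zero
  -- covariance between the two blocks implies independence of the blocks.
  have hXZ : IsGaussianProcess (Sum.elim X Z) Pr := by
    refine isGaussianProcess_of_restrict_prod (hasGaussianLaw_increments_noise hW hε h_indep) ?_
    rintro (⟨t, i⟩ | k)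
    · obtain ⟨I, Λ, hΛ⟩ := exists_bridgeResidual_eq_clm T Sig P Om W ε t
      exact ⟨I, EuclideanSpace.proj i ∘L Λ, fun ω => by simp [X, hΛ]⟩
    · obtain ⟨Λ, hΛ⟩ := exists_centeredView_eq_clm T P W ε {⟨T, bot_le, le_refl T⟩} (by simp)
      exact ⟨_, EuclideanSpace.proj k ∘L Λ, fun ω => by simp [Z, hΛ]⟩
  have hind := hXZ.indepFun_of_covariance_eq_zero (fun p => hXZ.aemeasurable (.inl p))
    (fun k => hXZ.aemeasurable (.inr k)) fun p k => by
      have := covariance_bridgeResidual_centeredView (P := P) hT hW hSig hOm hε h_indep p.1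
        (Pi.single p.2 1) (Pi.single k 1)
      simpa only [single_one_dotProduct] using this
  have h1 : Measurable fun (x : Set.Icc (0 : ℝ≥0) T × Fin N → ℝ) (t : Set.Icc (0 : ℝ≥0) T) =>
      (WithLp.toLp 2 fun i => x (t, i) : EuclideanSpace ℝ (Fin N)) := by fun_prop
  have h2 : Measurable fun x : Fin K → ℝ => (WithLp.toLp 2 x : EuclideanSpace ℝ (Fin K)) := by
    fun_prop
  exact hind.comp h1 h2

omit [IsProbabilityMeasure Pr] in
theorem integral_bridgeResidual (hW : IsCorrelatedBrownianMotion a Sig W Pr)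
    (hε : HasLaw ε (multivariateGaussian 0 ((T : ℝ) • Om)) Pr) (t : Set.Icc (0 : ℝ≥0) T) :
    ∫ ω, bridgeResidual T Sig P Om W ε t ω ∂Pr = 0 := by
  have hV (r : ℝ≥0) : ∫ ω, (W r ω - W 0 ω) ∂Pr = 0 := by
    rw [(hW.hasLaw_sub_zero r).integral_eq, integral_id_multivariateGaussian]
  have hE : ∫ ω, ε ω ∂Pr = 0 := by
    rw [hε.integral_eq, integral_id_multivariateGaussian]
  have iV (r : ℝ≥0) : Integrable (fun ω => W r ω - W 0 ω) Pr :=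
    (hW.hasLaw_sub_zero r).hasGaussianLaw.integrable
  have iE : Integrable ε Pr := hε.hasGaussianLaw.integrable
  have iPV := (euclideanMulVecCLM P).integrable_comp (iV T)
  have iY : Integrable (centeredView T P W ε) Pr := iPV.add iE
  have hY : ∫ ω, centeredView T P W ε ω ∂Pr = 0 := by
    have h1 := (euclideanMulVecCLM P).integral_comp_comm (iV T)
    rw [hV, map_zero] at h1
    have h2 := integral_add iPV iE
    rw [h1, hE, add_zero] at h2
    exact h2
  have h1 := (euclideanMulVecCLM (betaOne T Sig P Om)).integral_comp_comm iY
  rw [hY, map_zero] at h1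
  have h2 := integral_sub (iV t)
    (((euclideanMulVecCLM (betaOne T Sig P Om)).integrable_comp iY).smul (t : ℝ))
  simp only [Pi.smul_apply, integral_smul, h1, hV, smul_zero, sub_zero] at h2
  exact h2

end Residual

/-! ### Invariance of the bridge properties under modification and pushforward -/

section PathLaw

variable {S : Type*} [MeasurableSpace S] {Q : Measure S} {N : ℕ} {T : ℝ≥0}
  {a : EuclideanSpace ℝ (Fin N)} {m : Set.Icc (0 : ℝ≥0) T → EuclideanSpace ℝ (Fin N)}
  {C : Set.Icc (0 : ℝ≥0) T → Set.Icc (0 : ℝ≥0) T → Matrix (Fin N) (Fin N) ℝ}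

theorem IsContinuousGaussianProcess.congr
    {B B' : Set.Icc (0 : ℝ≥0) T → S → EuclideanSpace ℝ (Fin N)}
    (hB : IsContinuousGaussianProcess B Q a m C) (h : ∀ᵐ ω ∂Q, ∀ t, B t ω = B' t ω) :
    IsContinuousGaussianProcess B' Q a m C where
  start := by
    filter_upwards [hB.start, h] with ω h1 h2
    rw [← h2, h1]
  gaussian := hB.gaussian.congr fun t => h.mono fun ω hω => hω t
  mean t := by
    rw [← hB.mean t]
    exact integral_congr_ae (h.mono fun ω hω => (hω t).symm)
  cov s t i j := by
    rw [← hB.cov s t i j]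
    have hi (r : Set.Icc (0 : ℝ≥0) T) (k : Fin N) :
        ∫ ω, B' r ω k ∂Q = ∫ ω, B r ω k ∂Q :=
      integral_congr_ae (h.mono fun ω hω => by simp only [hω])
    rw [covariance, covariance, hi, hi]
    exact integral_congr_ae (h.mono fun ω hω => by simp only [hω])
  continuous_paths := by
    filter_upwards [hB.continuous_paths, h] with ω h1 h2 i
    simpa only [h2] using h1 i

theorem isContinuousGaussianProcess_map_iff {X : S → PathSpace T N} (hX : Measurable X) :
    IsContinuousGaussianProcess pathEval (Q.map X) a m C ↔
      IsContinuousGaussianProcess (fun t ω => X ω t) Q a m C := by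
  have hc (w : PathSpace T N) (i : Fin N) : Continuous fun t => w t i := by fun_prop
  have hstart : (∀ᵐ w ∂Q.map X, pathEval ⟨0, le_refl 0, bot_le⟩ w = a) ↔
      ∀ᵐ ω ∂Q, X ω ⟨0, le_refl 0, bot_le⟩ = a :=
    ae_map_iff hX.aemeasurable ((measurable_pathEval _) (measurableSet_singleton a))
  have hgauss : IsGaussianProcess pathEval (Q.map X) ↔
      IsGaussianProcess (fun t ω => X ω t) Q := by
    have heq (I : Finset (Set.Icc (0 : ℝ≥0) T)) :
        (Q.map X).map (fun w => I.restrict (pathEval · w)) =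
          Q.map fun ω => I.restrict fun t => X ω t := by
      exact Measure.map_map ((Finset.measurable_restrict I).comp
        (measurable_pi_lambda _ fun t => measurable_pathEval t)) hX
    refine ⟨fun h => ⟨fun I => ⟨?_⟩⟩, fun h => ⟨fun I => ⟨?_⟩⟩⟩
    · rw [← heq]
      exact (h.hasGaussianLaw I).isGaussian_map
    · rw [heq]
      exact (h.hasGaussianLaw I).isGaussian_map
  have hmean (t : Set.Icc (0 : ℝ≥0) T) : ∫ w, pathEval t w ∂Q.map X = ∫ ω, X ω t ∂Q :=
    integral_map hX.aemeasurable (measurable_pathEval t).stronglyMeasurable.aestronglyMeasurable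
  have hev (t : Set.Icc (0 : ℝ≥0) T) (i : Fin N) :
      AEStronglyMeasurable (fun w : PathSpace T N => pathEval t w i) (Q.map X) :=
    ((EuclideanSpace.proj (𝕜 := ℝ) i).continuous.measurable.comp
      (measurable_pathEval t)).stronglyMeasurable.aestronglyMeasurable
  have hcov (s t : Set.Icc (0 : ℝ≥0) T) (i j : Fin N) :
      cov[fun w => pathEval t w i, fun w => pathEval s w j; Q.map X] =
        cov[fun ω => X ω t i, fun ω => X ω s j; Q] :=
    covariance_map_fun (hev t i) (hev s j) hX.aemeasurable
  exact ⟨fun h => ⟨hstart.1 h.start, hgauss.1 h.gaussian, fun t => (hmean t).symm.trans (h.mean t),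
      fun s t i j => (hcov s t i j).symm.trans (h.cov s t i j), .of_forall fun ω => hc (X ω)⟩,
    fun h => ⟨hstart.2 h.start, hgauss.2 h.gaussian, fun t => (hmean t).trans (h.mean t),
      fun s t i j => (hcov s t i j).trans (h.cov s t i j), .of_forall fun w => hc w⟩⟩

end PathLaw

/-! ### The bridge law as a translation kernel -/

section BridgeLaw

variable {S : Type*} [MeasurableSpace S] {Pr : Measure S} [IsProbabilityMeasure Pr]
  {N K : ℕ} {T : ℝ≥0} {a : EuclideanSpace ℝ (Fin N)} {Sig L : Matrix (Fin N) (Fin N) ℝ}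
  {P : Matrix (Fin K) (Fin N) ℝ} {Om : Matrix (Fin K) (Fin K) ℝ}
  {W : ℝ≥0 → S → EuclideanSpace ℝ (Fin N)} {ε : S → EuclideanSpace ℝ (Fin K)}

/-- The conditional mean as a path. -/
noncomputable def bridgeMeanPath (T : ℝ≥0) (a : EuclideanSpace ℝ (Fin N))
    (Sig : Matrix (Fin N) (Fin N) ℝ) (P : Matrix (Fin K) (Fin N) ℝ)
    (Om : Matrix (Fin K) (Fin K) ℝ) (y : EuclideanSpace ℝ (Fin K)) : PathSpace T N :=
  ⟨bridgeMean T a Sig P Om y, by unfold bridgeMean; fun_prop⟩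

theorem continuous_bridgeMeanPath : Continuous (bridgeMeanPath T a Sig P Om) := by
  refine ContinuousMap.continuous_of_continuous_uncurry _ ?_
  change Continuous fun p : EuclideanSpace ℝ (Fin K) × Set.Icc (0 : ℝ≥0) T =>
    bridgeMean T a Sig P Om p.1 p.2
  unfold bridgeMean
  fun_prop

theorem measurable_noisyView (hW : ∀ t, Measurable (W t)) (hε : Measurable ε) :
    Measurable (noisyView T P W ε) :=
  ((continuous_euclideanMulVec P).measurable.comp (hW T)).add hε

omit [IsProbabilityMeasure Pr] in
theorem noisyView_ae_eq (hW : IsCorrelatedBrownianMotion a Sig W Pr) :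
    ∀ᵐ ω ∂Pr, noisyView T P W ε ω = centeredView T P W ε ω + euclideanMulVec P a := by
  filter_upwards [hW.start] with ω hω
  have h := euclideanMulVec_add P (W T ω - W 0 ω) (W 0 ω)
  rw [sub_add_cancel] at h
  rw [noisyView, centeredView, h, hω]
  abel

-- The decomposition of W(t) into residual and conditional mean: almost surely Y - Pa is the
-- centered observation and W(0) = a.
omit [IsProbabilityMeasure Pr] in
theorem sub_bridgeMean_ae_eq (hW : IsCorrelatedBrownianMotion a Sig W Pr) :
    ∀ᵐ ω ∂Pr, ∀ t : Set.Icc (0 : ℝ≥0) T,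
      W t ω - bridgeMean T a Sig P Om (noisyView T P W ε ω) t =
        bridgeResidual T Sig P Om W ε t ω := by
  filter_upwards [hW.start, noisyView_ae_eq (T := T) (P := P) (ε := ε) hW] with ω h1 h2 t
  rw [h2, bridgeMean, bridgeResidual, h1, add_sub_cancel_right, sub_sub]

theorem isOpenPosMeasure_map_noisyView (hT : 0 < T) (hW : IsCorrelatedBrownianMotion a Sig W Pr)
    (hOm : Om.PosDef) (hε_meas : Measurable ε)
    (hε : HasLaw ε (multivariateGaussian 0 ((T : ℝ) • Om)) Pr)
    (h_indep : IndepFun (fun ω (t : Set.Icc (0 : ℝ≥0) T) => W t ω) ε Pr) :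
    (Pr.map (noisyView T P W ε)).IsOpenPosMeasure := by
  have hP := (continuous_euclideanMulVec P).measurable
  have : (Pr.map ε).IsOpenPosMeasure := by
    rw [hε.map_eq]
    exact isOpenPosMeasure_multivariateGaussian _ (hOm.smul (NNReal.coe_pos.2 hT))
  have hind : IndepFun (fun ω => euclideanMulVec P (W T ω)) ε Pr :=
    h_indep.comp (hP.comp (measurable_pi_apply
      (⟨T, bot_le, le_refl T⟩ : Set.Icc (0 : ℝ≥0) T))) measurable_id
  exact hind.isOpenPosMeasure_map_add (hP.comp (hW.measurable T)) hε_meas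

/-- The residual process, shifted by the conditional mean, has the law of the bridge. -/
theorem isContinuousGaussianProcess_bridgeResidual_add (hT : 0 < T) (hSig : Sig.PosDef)
    (hL : IsCholeskyFactor Sig L) (hOm : Om.PosDef) (hW : IsCorrelatedBrownianMotion a Sig W Pr)
    (hε : HasLaw ε (multivariateGaussian 0 ((T : ℝ) • Om)) Pr)
    (h_indep : IndepFun (fun ω (t : Set.Icc (0 : ℝ≥0) T) => W t ω) ε Pr)
    (y : EuclideanSpace ℝ (Fin K)) :
    IsContinuousGaussianProcess
      (fun t ω => bridgeResidual T Sig P Om W ε t ω + bridgeMean T a Sig P Om y t) Pr a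
      (bridgeMean T a Sig P Om y) (bridgeCov T Sig L P Om) where
  start := .of_forall fun ω => by simp [bridgeResidual, bridgeMean]
  gaussian := (isGaussianProcess_bridgeResidual hW hε h_indep).add_const _
  mean t := by
    rw [integral_add
      ((isGaussianProcess_bridgeResidual hW hε h_indep).hasGaussianLaw_eval t).integrable
      (integrable_const _), integral_bridgeResidual hW hε]
    simp
  cov s t i j := by
    have hmem (t : Set.Icc (0 : ℝ≥0) T) (i : Fin N) :
        Integrable (fun ω => bridgeResidual T Sig P Om W ε t ω i) Pr :=
      (((isGaussianProcess_bridgeResidual hW hε h_indep).hasGaussianLaw_eval t).map_fun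
        (EuclideanSpace.proj (𝕜 := ℝ) i)).integrable
    have h := covariance_bridgeResidual (P := P) hT hW hSig hOm hε h_indep t s
      (Pi.single i 1) (Pi.single j 1)
    simp only [single_one_dotProduct, Matrix.mulVec_single_one] at h
    rw [bridgeCov_eq hL hSig]
    simp only [PiLp.add_apply]
    rw [covariance_add_const_left (hmem t i), covariance_add_const_right (hmem s j), h]
    rfl
  continuous_paths := by
    filter_upwards [hW.continuous_paths] with ω hω i
    unfold bridgeResidual bridgeMean
    have h1 : Continuous fun t : Set.Icc (0 : ℝ≥0) T => W t ω := hω.comp continuous_subtype_val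
    have h2 : Continuous fun t : Set.Icc (0 : ℝ≥0) T => ((t : ℝ≥0) : ℝ) := by fun_prop
    exact (EuclideanSpace.proj (𝕜 := ℝ) i).continuous.comp (((h1.sub continuous_const).sub
      (h2.smul continuous_const)).add (continuous_const.add (h2.smul continuous_const)))

/-- The conditional law of the path is a translation kernel, and all its values are bridge laws. -/
theorem exists_bridgeKernel (hT : 0 < T) (hSig : Sig.PosDef)
    (hL : IsCholeskyFactor Sig L) (hOm : Om.PosDef) (hW : IsCorrelatedBrownianMotion a Sig W Pr)
    (hε_meas : Measurable ε) (hε : HasLaw ε (multivariateGaussian 0 ((T : ℝ) • Om)) Pr)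
    (h_indep : IndepFun (fun ω (t : Set.Icc (0 : ℝ≥0) T) => W t ω) ε Pr) :
    ∃ ν : Kernel (EuclideanSpace ℝ (Fin K)) (PathSpace T N), ∃ X : S → PathSpace T N,
      IsMarkovKernel ν ∧ IsWeaklyContinuousKernel ν ∧ Measurable X ∧
      (∀ᵐ ω ∂Pr, ∀ t : Set.Icc (0 : ℝ≥0) T, W t ω = X ω t) ∧
      HasCondDistrib X (noisyView T P W ε) ν Pr ∧
      ∀ y, IsContinuousGaussianProcess pathEval (ν y) a (bridgeMean T a Sig P Om y)
        (bridgeCov T Sig L P Om) := by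
  obtain ⟨X, hX, hXW⟩ := exists_measurable_path hW.measurable hW.continuous_paths T
  have hY := measurable_noisyView (T := T) (P := P) hW.measurable hε_meas
  have hh := (continuous_bridgeMeanPath (T := T) (a := a) (Sig := Sig) (P := P) (Om := Om))
  let R : S → PathSpace T N := fun ω => X ω - bridgeMeanPath T a Sig P Om (noisyView T P W ε ω)
  have hR : Measurable R := hX.sub (hh.measurable.comp hY)
  have hRW : ∀ᵐ ω ∂Pr, ∀ t, R ω t = bridgeResidual T Sig P Om W ε t ω := by
    filter_upwards [hXW, sub_bridgeMean_ae_eq (T := T) (P := P) (Om := Om) (ε := ε) hW]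
      with ω h1 h2 t
    rw [← h2, h1]
    rfl
  have hind : IndepFun R (noisyView T P W ε) Pr := by
    refine indepFun_pathSpace_of_coe ?_
    refine ((indepFun_bridgeResidual_centeredView (P := P) hT hW hSig hOm hε h_indep).comp
      measurable_id (measurable_add_const (euclideanMulVec P a))).congr ?_ ?_
    · filter_upwards [hRW] with ω hω
      exact funext fun t => (hω t).symm
    · filter_upwards [noisyView_ae_eq (T := T) (P := P) (ε := ε) hW] with ω hω
      exact hω.symm
  have := Measure.isProbabilityMeasure_map (μ := Pr) hR.aemeasurable
  refine ⟨translateKernel (Pr.map R) (bridgeMeanPath T a Sig P Om), X,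
    isMarkovKernel_translateKernel _ hh.measurable,
    isWeaklyContinuousKernel_translateKernel _ hh.measurable hh, hX, hXW, ?_, fun y => ?_⟩
  · simpa [R] using hasCondDistrib_translateKernel hR hY hh.measurable hind
  · rw [translateKernel_apply _ hh.measurable, Measure.map_map (by fun_prop) hR,
      isContinuousGaussianProcess_map_iff (by fun_prop)]
    refine (isContinuousGaussianProcess_bridgeResidual_add hT hSig hL hOm hW hε h_indep y).congr ?_
    filter_upwards [hRW] with ω hω t
    rw [← hω]
    rfl

end BridgeLaw

/-! ### Transfer to arbitrary versions of the conditional law -/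

theorem proposition3 {S : Type*} [MeasurableSpace S] (Pr : Measure S) [IsProbabilityMeasure Pr]
    {N K : ℕ} (T : ℝ≥0) (hT : 0 < T)
    (a : EuclideanSpace ℝ (Fin N))
    (Sig L : Matrix (Fin N) (Fin N) ℝ) (hSig : Sig.PosDef) (hL : IsCholeskyFactor Sig L)
    (P : Matrix (Fin K) (Fin N) ℝ) (hP : ∀ j, P *ᵥ (fun i => L i j) ≠ 0)
    (Om : Matrix (Fin K) (Fin K) ℝ) (hOm : Om.PosDef)
    (W : ℝ≥0 → S → EuclideanSpace ℝ (Fin N)) (hW : IsCorrelatedBrownianMotion a Sig W Pr)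
    (ε : S → EuclideanSpace ℝ (Fin K)) (hε_meas : Measurable ε)
    (hε : HasLaw ε (multivariateGaussian 0 ((T : ℝ) • Om)) Pr)
    (h_indep : IndepFun (fun ω (t : Set.Icc (0 : ℝ≥0) T) => W t ω) ε Pr) :
    -- under every regular conditional probability `κ y = Pr( · | Y(0,T) = y)`, for almost every
    -- value `y` of `Y(0,T)`
    (∀ κ : Kernel (EuclideanSpace ℝ (Fin K)) S,
      IsRegularCondProb Pr (noisyView T P W ε) κ →
      ∀ᵐ y ∂(Pr.map (noisyView T P W ε)),
        IsContinuousGaussianProcess (fun t : Set.Icc (0 : ℝ≥0) T => W t) (κ y) a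
          (bridgeMean T a Sig P Om y) (bridgeCov T Sig L P Om)) ∧
    -- for every `y`, under the weakly continuous version of the conditional law of the path
    (∃ ν : Kernel (EuclideanSpace ℝ (Fin K)) (PathSpace T N),
      IsCondPathLaw T W (noisyView T P W ε) Pr ν ∧ IsWeaklyContinuousKernel ν) ∧
    (∀ ν : Kernel (EuclideanSpace ℝ (Fin K)) (PathSpace T N),
      IsCondPathLaw T W (noisyView T P W ε) Pr ν → IsWeaklyContinuousKernel ν →
      ∀ y : EuclideanSpace ℝ (Fin K),
        IsContinuousGaussianProcess pathEval (ν y) a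
          (bridgeMean T a Sig P Om y) (bridgeCov T Sig L P Om)) ∧
    -- the matrix `H`
    (bridgeMatrix T Sig L P Om).IsSymm ∧ (bridgeMatrix T Sig L P Om).PosSemidef ∧
    (∀ i, 0 < bridgeMatrix T Sig L P Om i i) ∧
    ((bridgeMatrix T Sig L P Om).PosDef ↔ Function.Injective P.mulVec) := by
  obtain ⟨ν₀, X, hMk, hcont, hX, hXW, hcd, hgauss⟩ :=
    exists_bridgeKernel (P := P) hT hSig hL hOm hW hε_meas hε h_indep
  have hY := measurable_noisyView (T := T) (P := P) hW.measurable hε_meas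
  have := Measure.isProbabilityMeasure_map (μ := Pr) hY.aemeasurable
  have := isOpenPosMeasure_map_noisyView (P := P) hT hW hOm hε_meas hε h_indep
  have hpath : IsCondPathLaw T W (noisyView T P W ε) Pr ν₀ := by
    refine ⟨hMk, (hcd.comp_left measurable_pathCoe).congr ?_⟩
    filter_upwards [hXW] with ω hω
    exact Prod.ext rfl (funext hω)
  refine ⟨fun κ hκ => ?_, ⟨ν₀, hpath, hcont⟩, fun ν hν hνc y => ?_, bridgeMatrix_isSymm hSig hOm,
    bridgeMatrix_posSemidef hSig hOm L P, bridgeMatrix_diag_pos hT hSig hOm hP,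
    bridgeMatrix_posDef_iff hT hSig hL hOm⟩
  · obtain ⟨hκM, hκ⟩ := hκ
    -- Pushing κ forward along X gives another conditional law of X given Y, so it agrees almost
    -- everywhere with ν₀.
    have h1 : ∀ᵐ y ∂Pr.map (noisyView T P W ε), κ.map X y = ν₀ y := by
      refine Kernel.compProd_eq_iff.1 ?_
      rw [← (hκ.comp_left hX).map_eq, ← hcd.map_eq]
      rfl
    -- The almost sure identity W = X must also hold under κ y; it disintegrates along Y after
    -- passing to a measurable set `G` of full measure.
    have h2 : ∀ᵐ y ∂Pr.map (noisyView T P W ε), ∀ᵐ ω ∂κ y,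
        ∀ t : Set.Icc (0 : ℝ≥0) T, W t ω = X ω t := by
      refine Measure.ae_ae_of_ae_compProd (p := fun z : EuclideanSpace ℝ (Fin K) × S =>
        ∀ t : Set.Icc (0 : ℝ≥0) T, W t z.2 = X z.2 t) ?_
      rw [← hκ.map_eq]
      obtain ⟨G, hG, hGm, hGX⟩ := hXW.exists_measurable_mem
      have h3 : ∀ᵐ z ∂Pr.map fun ω => (noisyView T P W ε ω, ω), z.2 ∈ G :=
        (ae_map_iff (hY.prodMk measurable_id).aemeasurable (measurable_snd hGm)).2 hG
      exact h3.mono fun z hz => hGX z.2 hz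
    filter_upwards [h1, h2] with y hy1 hy2
    have h := hgauss y
    rw [← hy1, Kernel.map_apply _ hX, isContinuousGaussianProcess_map_iff hX] at h
    exact h.congr (hy2.mono fun ω hω t => (hω t).symm)
  · obtain ⟨hνM, hν⟩ := hν
    have h1 : ∀ᵐ y ∂Pr.map (noisyView T P W ε), ν y = ν₀ y :=
      ae_eq_of_compProd_map_pathCoe_eq (by rw [← hν.map_eq, ← hpath.2.map_eq])
    -- Full support of the law of Y upgrades almost every y to every y.
    rw [hνc.eq_of_ae_eq hcont h1 y]
    exact hgauss y
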